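/- Let $T,d\ge 0$ be integers, $I=\{0,1,\dots,T\}$, and equip $\mathbb R^d$ and $\mathbb R\oplus\mathbb R^d$ with their Euclidean norms, the tensor powers $(\mathbb R\oplus\mathbb R^d)^{\otimes m}$ with the Euclidean (Hilbert–Schmidt) norms, and the space $(I\to\mathbb R^d)$ of paths with the norm $\|x\|_\infty=\max_{t\in I}|x(t)|$ and its Borel $\sigma$-algebra. For a tensor series $\mathbf t=(\mathbf t_m)_{m\ge0}\in\prod_{m\ge0}(\mathbb R\oplus\mathbb R^d)^{\otimes m}$ and $r\in\{1,2\}$ put $\|\mathbf t\|_r=\big(\sum_{m\ge0}\|\mathbf t_m\|^r\big)^{1/r}$ and let $\mathbf T^{(r)}$ be the space of those $\mathbf t$ with $\|\mathbf t\|_r<\infty$ (a Banach space for $r=1$, a Hilbert space for $r=2$). Write $\delta_a\mathbf t=(a^m\mathbf t_m)_{m\ge0}$ for the dilation by $a\in\mathbb R$. The (time-augmented, rank $1$) signature of a path $x$ is $$S(x)=\exp(\Delta_0x)\cdot\exp(\Delta_1x)\cdots\exp(\Delta_Tx),\qquad \Delta_0x=(1,x(0)),\quad \Delta_tx=(1,x(t)-x(t-1))\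 \ (1\le t\le T),$$ where $\exp(v)=(v^{\otimes m}/m!)_{m\ge0}$ and $(\mathbf s\cdot\mathbf t)_m=\sum_{i=0}^m\mathbf s_i\otimes\mathbf t_{m-i}$. Let $p,q\in\{1,2\}$. The robust signature is $$\Phi(x)=\delta_{\exp(-\|S(x)\|_p-\|x\|_\infty)}\,S(x)\in\mathbf T^{(q)},$$ and for Borel probability measures $\mu,\nu$ on $(I\to\mathbb R^d)$ set $$d_0(\mu,\nu)=\Big\|\int\Phi(x)\,\mu(dx)-\int\Phi(x)\,\nu(dx)\Big\|_q .$$ (For $q=2$ this is the maximum mean discrepancy of the kernel $\mathbf k(x,y)=\langle\Phi(x),\Phi(y)\rangle-1$.) Then $\Phi$ is Bochner integrable with respect to every Borel probability measure on $(I\to\mathbb R^d)$, so that $d_0$ is well defined, and for every sequence $(\mu_n)$ and every $\mu$ in $\operatorname{Prob}(I\to\mathbb R^d)$: $\mu_n$ converges weakly to $\mu$ if and only if $\lim_{n\to\infty}d_0(\mu_n,\mu)=0$. -/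

import Mathlib

open Filter Topology MeasureTheory
open scoped ENNReal Nat

noncomputable section

namespace RobustSignature

/-- A path `I → ℝ^d`, `I = {0, …, T}`, with `ℝ^d` Euclidean. The norm that Lean puts on this type is
`‖x‖_∞ = max_t |x t|`, and its topology and σ-algebra are the usual ones of `(ℝ^d)^{T+1}`. -/
abbrev PathSpace (T d : ℕ) : Type := Fin (T + 1) → EuclideanSpace ℝ (Fin d)

/-- Elements of `∏_{m ≥ 0} (ℝ ⊕ ℝ^d)^{⊗ m}`, given by their coordinates in the standard basis
`e_{i₁} ⊗ ⋯ ⊗ e_{i_m}`, that is by one real number for every word in the letters `0, …, d`.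
The letter `0` is the time coordinate. -/
abbrev TensorSeries (d : ℕ) : Type := List (Fin (d + 1)) → ℝ

variable {T d : ℕ}

/-- The tensor `1 = (1, 0, 0, …)`. -/
def tensorOne : TensorSeries d := fun w => if w = [] then 1 else 0

/-- The tensor convolution product: the coordinate of `(s · t)_m = ∑_{i ≤ m} s_i ⊗ t_{m-i}`
at a word `w` of length `m`. -/
def tensorMul (s t : TensorSeries d) : TensorSeries d :=
  fun w => ∑ i ∈ Finset.range (w.length + 1), s (w.take i) * t (w.drop i)

/-- The tensor exponential `(v^{⊗ m} / m!)_{m ≥ 0}`. -/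
def tensorExp (v : Fin (d + 1) → ℝ) : TensorSeries d :=
  fun w => (w.map v).prod / (w.length ! : ℝ)

/-- The dilation `δ_a t = (t_0, a t_1, a² t_2, …)`. -/
def dilate (a : ℝ) (s : TensorSeries d) : TensorSeries d := fun w => a ^ w.length * s w

/-- The time-augmented increments of a path, `Δ_0 x = (1, x 0)` and `Δ_t x = (1, x t - x (t-1))`. -/
def increment (x : PathSpace T d) (t : Fin (T + 1)) : Fin (d + 1) → ℝ :=
  Fin.cons 1 (x t - Fin.cases 0 (fun s : Fin T => x s.castSucc) t : EuclideanSpace ℝ (Fin d))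

/-- The coordinates of the signature `S(x) = exp(Δ_0 x) · exp(Δ_1 x) ⋯ exp(Δ_T x)`. -/
def sigCoeff (x : PathSpace T d) : TensorSeries d :=
  (List.ofFn fun t => tensorExp (increment x t)).foldr tensorMul tensorOne

/-- The space `(ℝ ⊕ ℝ^d)^{⊗ m}` with its Euclidean (Hilbert–Schmidt) norm. -/
abbrev Level (d m : ℕ) : Type := EuclideanSpace ℝ (Fin m → Fin (d + 1))

/-- The component of degree `m` of a tensor series. -/
def level (s : TensorSeries d) (m : ℕ) : Level d m :=
  WithLp.toLp 2 fun w => s (List.ofFn w)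

/-- Tensor series with finite norm `(∑_m ‖t_m‖^p)^{1/p}`. For `p = 1` this is the Banach space
completion of the tensor algebra of `ℝ ⊕ ℝ^d` for the norm `∑_m ‖t_m‖`, for `p = 2` it is the Hilbert
space completion for the inner product `∑_m ⟪s_m, t_m⟫`. -/
abbrev TensorSpace (d : ℕ) (p : ℝ≥0∞) : Type := lp (Level d) p

/-- Factorial decay of the coordinates. -/
def FactorialDecay (s : TensorSeries d) : Prop :=
  ∃ C : ℝ, 0 ≤ C ∧ ∀ w, |s w| ≤ C ^ w.length / (w.length ! : ℝ)

theorem factorialDecay_one : FactorialDecay (tensorOne : TensorSeries d) := by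
  refine ⟨0, le_rfl, fun w => ?_⟩
  rcases w with _ | ⟨a, w⟩ <;> simp [tensorOne]

theorem factorialDecay_exp (v : Fin (d + 1) → ℝ) : FactorialDecay (tensorExp v) := by
  refine ⟨‖v‖, norm_nonneg _, fun w => ?_⟩
  have h : |(w.map v).prod| ≤ ‖v‖ ^ w.length := by
    induction w with
    | nil => simp
    | cons a w ih =>
      rw [List.map_cons, List.prod_cons, abs_mul, List.length_cons, pow_succ']
      exact mul_le_mul (norm_le_pi_norm v a) ih (abs_nonneg _) (norm_nonneg _)
  rw [tensorExp, abs_div, Nat.abs_cast]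
  gcongr

theorem FactorialDecay.mul {s t : TensorSeries d} (hs : FactorialDecay s) (ht : FactorialDecay t) :
    FactorialDecay (tensorMul s t) := by
  obtain ⟨A, hA, hs⟩ := hs
  obtain ⟨B, hB, ht⟩ := ht
  refine ⟨A + B, add_nonneg hA hB, fun w => ?_⟩
  rw [add_pow, Finset.sum_div]
  refine (Finset.abs_sum_le_sum_abs _ _).trans (Finset.sum_le_sum fun i hi => ?_)
  have hi' : i ≤ w.length := Nat.lt_succ_iff.mp (Finset.mem_range.mp hi)
  have h1 := hs (w.take i)
  have h2 := ht (w.drop i)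
  rw [List.length_take, min_eq_left hi'] at h1
  rw [List.length_drop] at h2
  rw [abs_mul]
  refine (mul_le_mul h1 h2 (abs_nonneg _) (by positivity)).trans (le_of_eq ?_)
  rw [Nat.cast_choose ℝ hi']
  field_simp

theorem FactorialDecay.dilate {s : TensorSeries d} (hs : FactorialDecay s) (a : ℝ) :
    FactorialDecay (dilate a s) := by
  obtain ⟨C, hC, hs⟩ := hs
  refine ⟨|a| * C, by positivity, fun w => ?_⟩
  rw [RobustSignature.dilate, abs_mul, abs_pow, mul_pow, mul_div_assoc]
  gcongr
  exact hs w

theorem factorialDecay_sigCoeff (x : PathSpace T d) : FactorialDecay (sigCoeff x) := by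
  have h : ∀ l : List (TensorSeries d), (∀ s ∈ l, FactorialDecay s) →
      FactorialDecay (l.foldr tensorMul tensorOne) := by
    intro l
    induction l with
    | nil => exact fun _ => factorialDecay_one
    | cons s l ih =>
      intro hl
      exact (hl s (by simp)).mul (ih fun t ht => hl t (by simp [ht]))
  refine h _ fun s hs => ?_
  obtain ⟨t, rfl⟩ := (List.mem_ofFn' _ _).mp hs
  exact factorialDecay_exp _

theorem FactorialDecay.memℓp {s : TensorSeries d} (hs : FactorialDecay s) (p : ℝ≥0∞)
    [hp : Fact (1 ≤ p)] : Memℓp (level s) p := by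
  refine Memℓp.of_exponent_ge ?_ hp.out
  obtain ⟨C, hC, hs⟩ := hs
  refine memℓp_gen ?_
  simp only [ENNReal.toReal_one, Real.rpow_one]
  refine Summable.of_nonneg_of_le (fun m => norm_nonneg _) (fun m => ?_)
    (Real.summable_pow_div_factorial (((d : ℝ) + 1) * C))
  have hD : (0 : ℝ) ≤ C ^ m / (m ! : ℝ) := by positivity
  have hd : (1 : ℝ) ≤ ((d : ℝ) + 1) ^ m := one_le_pow₀ (by linarith [Nat.cast_nonneg (α := ℝ) d])
  rw [EuclideanSpace.norm_eq, mul_pow, mul_div_assoc]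
  refine Real.sqrt_le_iff.mpr ⟨by positivity, ?_⟩
  have h : ∀ w : Fin m → Fin (d + 1), ‖level s m w‖ ^ 2 ≤ (C ^ m / (m ! : ℝ)) ^ 2 := by
    intro w
    have := hs (List.ofFn w)
    rw [List.length_ofFn] at this
    exact pow_le_pow_left₀ (norm_nonneg _) this 2
  refine (Finset.sum_le_sum fun w _ => h w).trans ?_
  rw [Finset.sum_const, Finset.card_univ, Fintype.card_fun, Fintype.card_fin, Fintype.card_fin,
    nsmul_eq_mul, mul_pow]
  push_cast
  gcongr
  exact le_self_pow₀ hd two_ne_zero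

/-- The signature `S(x)` as an element of the normed space of tensor series. -/
def sig (p : ℝ≥0∞) [Fact (1 ≤ p)] (x : PathSpace T d) : TensorSpace d p :=
  ⟨level (sigCoeff x), (factorialDecay_sigCoeff x).memℓp p⟩

/-- The scaling `exp(-‖S(x)‖ - ‖x‖_∞)`, with the norm of index `p` of the signature. -/
def scaling (p : ℝ≥0∞) [Fact (1 ≤ p)] (x : PathSpace T d) : ℝ :=
  Real.exp (-‖sig p x‖ - ‖x‖)

/-- The robust signature `δ_{exp(-‖S(x)‖ - ‖x‖_∞)} S(x)`, with the norm of index `p` in the exponent,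
as an element of the space of tensor series with the norm of index `q`. -/
def robustSig (p q : ℝ≥0∞) [Fact (1 ≤ p)] [Fact (1 ≤ q)] (x : PathSpace T d) : TensorSpace d q :=
  ⟨level (dilate (scaling p x) (sigCoeff x)),
    ((factorialDecay_sigCoeff x).dilate (scaling p x)).memℓp q⟩

/-- The robust expected signature `∫ S(x) μ(dx)`, a Bochner integral. -/
def expectedRobustSig (p q : ℝ≥0∞) [Fact (1 ≤ p)] [Fact (1 ≤ q)]
    (μ : ProbabilityMeasure (PathSpace T d)) : TensorSpace d q :=
  ∫ x, robustSig p q x ∂(μ : Measure (PathSpace T d))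

/-- The distance `d_0(μ, ν)`, the norm of the difference of the robust expected signatures. For
`q = 2` it is the maximum mean discrepancy of the kernel `⟪robustSig x, robustSig y⟫ - 1`. -/
def d0 (p q : ℝ≥0∞) [Fact (1 ≤ p)] [Fact (1 ≤ q)] (μ ν : ProbabilityMeasure (PathSpace T d)) : ℝ :=
  ‖expectedRobustSig p q μ - expectedRobustSig p q ν‖

end RobustSignature

end

/-!
The coordinates of `S(x)` form a character of the shuffle algebra: products of coordinates are sums
of coordinates. The characters with values in `[-1, 1]` form a compact set, on which the coordinate
functions therefore span a point-separating algebra, so that by Stone–Weierstrass their integrals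
determine weak convergence.

The robust signature embeds path space into this compact set. It is injective because the time
coordinate reveals the dilation, and the coordinates at the words `c 0 ⋯ 0` reveal the increments of
the path. It is a homeomorphism onto its image because it tends at infinity to `1`, a value that it
does not take, so that it extends to an injective continuous map on the one-point compactification.

Finally, `exp(-‖S(x)‖ - ‖x‖) * ‖S(x)‖ ≤ exp(-1)` bounds the component of degree `m` of the robust
signature by `exp(-1) ^ m`, uniformly in `x`, so convergence of the expected robust signatures in
norm is the same as convergence of all of their coordinates.
-/

noncomputable section

namespace RobustSignature

section Shuffle

variable {α R : Type*}

/-- The list, with multiplicity, of all interleavings of two words: the terms of their shuffle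
product. -/
def shuffles : List α → List α → List (List α)
  | [], u => [u]
  | a :: w, [] => [a :: w]
  | a :: w, b :: u =>
    (shuffles w (b :: u)).map (List.cons a) ++ (shuffles (a :: w) u).map (List.cons b)
termination_by w u => w.length + u.length

@[simp] theorem shuffles_nil_left (u : List α) : shuffles [] u = [u] := by
  rw [shuffles]

@[simp] theorem shuffles_nil_right (w : List α) : shuffles w [] = [w] := by
  cases w <;> rw [shuffles]

theorem shuffles_cons_cons (a b : α) (w u : List α) :
    shuffles (a :: w) (b :: u) =
      (shuffles w (b :: u)).map (List.cons a) ++ (shuffles (a :: w) u).map (List.cons b) := by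
  rw [shuffles]

theorem shuffle_induction {P : List α → List α → Prop} (nil_left : ∀ u, P [] u)
    (nil_right : ∀ w, P w [])
    (cons_cons : ∀ a w b u, P w (b :: u) → P (a :: w) u → P (a :: w) (b :: u)) (w u : List α) :
    P w u := by
  induction w generalizing u with
  | nil => exact nil_left u
  | cons a w ihw =>
    induction u with
    | nil => exact nil_right _
    | cons b u ihu => exact cons_cons a w b u (ihw _) ihu

theorem length_shuffles (w u : List α) :
    (shuffles w u).length = (w.length + u.length).choose w.length := by
  induction w, u using shuffle_induction with
  | nil_left u => simp
  | nil_right w => simp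
  | cons_cons a w b u ihw ihu =>
    rw [shuffles_cons_cons, List.length_append, List.length_map, List.length_map, ihw, ihu]
    simp only [List.length_cons, ← add_assoc, Nat.choose_succ_succ, add_right_comm _ 1]

theorem perm_append_of_mem_shuffles {w u z : List α} (hz : z ∈ shuffles w u) : z.Perm (w ++ u) := by
  induction w, u using shuffle_induction generalizing z with
  | nil_left u => simp_all
  | nil_right w => simp_all
  | cons_cons a w b u ihw ihu =>
    rw [shuffles_cons_cons, List.mem_append, List.mem_map, List.mem_map] at hz
    obtain ⟨z, hz, rfl⟩ | ⟨z, hz, rfl⟩ := hz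
    · exact (ihw hz).cons a
    · exact ((ihu hz).cons b).trans List.perm_middle.symm

/-- The character property for the shuffle product: the linear extension of `f` to the shuffle
algebra is a unital algebra homomorphism. -/
structure IsShuffleCharacter [Semiring R] (f : List α → R) : Prop where
  map_nil : f [] = 1
  sum_map_shuffles : ∀ w u, ((shuffles w u).map f).sum = f w * f u

theorem IsShuffleCharacter.pow_length_mul [CommSemiring R] {f : List α → R}
    (hf : IsShuffleCharacter f) (a : R) : IsShuffleCharacter fun w => a ^ w.length * f w := by
  refine ⟨by simp [hf.map_nil], fun w u => ?_⟩
  have hlength : ∀ z ∈ shuffles w u, a ^ z.length * f z = a ^ (w.length + u.length) * f z :=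
    fun z hz => by rw [(perm_append_of_mem_shuffles hz).length_eq, List.length_append]
  rw [List.map_congr_left hlength, List.sum_map_mul_left, hf.sum_map_shuffles, pow_add]
  ring

theorem isShuffleCharacter_prod_div_factorial [Field R] [CharZero R] (v : α → R) :
    IsShuffleCharacter fun w => (w.map v).prod / (w.length ! : R) := by
  refine ⟨by simp, fun w u => ?_⟩
  have hconst : ∀ z ∈ shuffles w u, (z.map v).prod / (z.length ! : R) =
      (w.map v).prod * (u.map v).prod / ((w.length + u.length)! : R) := fun z hz => by
    have hperm := perm_append_of_mem_shuffles hz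
    rw [(hperm.map v).prod_eq, hperm.length_eq, List.map_append, List.prod_append,
      List.length_append]
  have hfactorial : ∀ n : ℕ, (n ! : R) ≠ 0 := fun n => Nat.cast_ne_zero.mpr n.factorial_ne_zero
  rw [List.map_congr_left hconst, List.map_const', List.sum_replicate, length_shuffles,
    nsmul_eq_mul, Nat.cast_add_choose]
  field_simp [hfactorial]

theorem IsShuffleCharacter.span_range_mul_self_le {𝕜 : Type*} [CommSemiring 𝕜] [Semiring R]
    [Algebra 𝕜 R] {f : List α → R} (hf : IsShuffleCharacter f) :
    Submodule.span 𝕜 (Set.range f) * Submodule.span 𝕜 (Set.range f) ≤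
      Submodule.span 𝕜 (Set.range f) := by
  rw [Submodule.span_mul_span, Submodule.span_le]
  rintro _ ⟨_, ⟨w, rfl⟩, _, ⟨u, rfl⟩, rfl⟩
  change f w * f u ∈ Submodule.span 𝕜 (Set.range f)
  rw [← hf.sum_map_shuffles w u]
  refine list_sum_mem fun y hy => ?_
  obtain ⟨z, -, rfl⟩ := List.mem_map.mp hy
  exact Submodule.subset_span (Set.mem_range_self z)

/-- The subalgebra of linear combinations of the values of a shuffle character. -/
def IsShuffleCharacter.subalgebra (𝕜 : Type*) [CommSemiring 𝕜] [Semiring R] [Algebra 𝕜 R]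
    {f : List α → R} (hf : IsShuffleCharacter f) : Subalgebra 𝕜 R :=
  (Submodule.span 𝕜 (Set.range f)).toSubalgebra
    (hf.map_nil ▸ Submodule.subset_span (Set.mem_range_self []))
    fun _ _ hx hy => hf.span_range_mul_self_le (Submodule.mul_mem_mul hx hy)

end Shuffle

section TensorAlgebra

variable {d : ℕ}

theorem tensorMul_cons (s t : TensorSeries d) (a : Fin (d + 1)) (w : List (Fin (d + 1))) :
    tensorMul s t (a :: w) = tensorMul (fun z => s (a :: z)) t w + s [] * t (a :: w) := by
  simp [tensorMul, Finset.sum_range_succ']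

/-- Deconcatenation, the coproduct dual to `tensorMul`, is multiplicative for shuffles. -/
theorem sum_map_tensorMul_shuffles (s t : TensorSeries d) (w u : List (Fin (d + 1))) :
    ((shuffles w u).map (tensorMul s t)).sum =
      ∑ i ∈ Finset.range (w.length + 1), ∑ j ∈ Finset.range (u.length + 1),
        ((shuffles (w.take i) (u.take j)).map s).sum *
          ((shuffles (w.drop i) (u.drop j)).map t).sum := by
  induction w, u using shuffle_induction generalizing s with
  | nil_left u => simp [tensorMul]
  | nil_right w => simp [tensorMul]
  | cons_cons a w b u ihw ihu =>
    have map_cons (c : Fin (d + 1)) (l : List (List (Fin (d + 1)))) :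
        ((l.map (List.cons c)).map (tensorMul s t)).sum =
          (l.map (tensorMul (fun z => s (c :: z)) t)).sum +
            s [] * ((l.map (List.cons c)).map t).sum := by
      simp only [List.map_map, Function.comp_def, tensorMul_cons, List.sum_map_add,
        List.sum_map_mul_left]
    rw [shuffles_cons_cons, List.map_append, List.sum_append, map_cons, map_cons, ihw, ihu]
    simp only [List.length_cons, Finset.sum_range_succ' _ (u.length + 1),
      Finset.sum_range_succ' _ (w.length + 1), List.take_succ_cons, List.drop_succ_cons,
      List.take_zero, List.drop_zero, shuffles_cons_cons, shuffles_nil_left, shuffles_nil_right,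
      List.map_append, List.sum_append, List.map_map, Function.comp_def, List.map_cons,
      List.map_nil, List.sum_cons, List.sum_nil, add_zero, add_mul, Finset.sum_add_distrib]
    ring

theorem IsShuffleCharacter.tensorMul {s t : TensorSeries d} (hs : IsShuffleCharacter s)
    (ht : IsShuffleCharacter t) : IsShuffleCharacter (tensorMul s t) := by
  refine ⟨by simp [RobustSignature.tensorMul, hs.map_nil, ht.map_nil], fun w u => ?_⟩
  rw [sum_map_tensorMul_shuffles, RobustSignature.tensorMul, RobustSignature.tensorMul,
    Finset.sum_mul_sum]
  refine Finset.sum_congr rfl fun i _ => Finset.sum_congr rfl fun j _ => ?_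
  rw [hs.sum_map_shuffles, ht.sum_map_shuffles]
  ring

theorem isShuffleCharacter_tensorExp (v : Fin (d + 1) → ℝ) : IsShuffleCharacter (tensorExp v) :=
  isShuffleCharacter_prod_div_factorial v

theorem tensorExp_zero : tensorExp 0 = (tensorOne : TensorSeries d) := by
  funext w
  cases w <;> simp [tensorOne, tensorExp]

theorem isShuffleCharacter_tensorOne : IsShuffleCharacter (tensorOne : TensorSeries d) :=
  tensorExp_zero (d := d) ▸ isShuffleCharacter_tensorExp 0

theorem IsShuffleCharacter.dilate {s : TensorSeries d} (hs : IsShuffleCharacter s) (a : ℝ) :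
    IsShuffleCharacter (dilate a s) :=
  hs.pow_length_mul a

/-- The product `exp(V 0) ⋯ exp(V (n - 1))`, the signature of the path with increments `V`. -/
def tensorExpProd {n : ℕ} (V : Fin n → Fin (d + 1) → ℝ) : TensorSeries d :=
  (List.ofFn fun t => tensorExp (V t)).foldr tensorMul tensorOne

@[simp] theorem tensorExpProd_zero (V : Fin 0 → Fin (d + 1) → ℝ) :
    tensorExpProd V = tensorOne := by
  simp [tensorExpProd]

theorem tensorExpProd_succ {n : ℕ} (V : Fin (n + 1) → Fin (d + 1) → ℝ) :
    tensorExpProd V = tensorMul (tensorExp (V 0)) (tensorExpProd fun t => V t.succ) := by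
  simp [tensorExpProd, List.ofFn_succ]

theorem isShuffleCharacter_tensorExpProd {n : ℕ} (V : Fin n → Fin (d + 1) → ℝ) :
    IsShuffleCharacter (tensorExpProd V) := by
  induction n with
  | zero => exact tensorExpProd_zero V ▸ isShuffleCharacter_tensorOne
  | succ n ih =>
    exact tensorExpProd_succ V ▸ (isShuffleCharacter_tensorExp (V 0)).tensorMul (ih _)

theorem add_pow_div_factorial (x y : ℝ) (k : ℕ) :
    (x + y) ^ k / (k ! : ℝ) =
      ∑ j ∈ Finset.range (k + 1), x ^ j / (j ! : ℝ) * (y ^ (k - j) / ((k - j)! : ℝ)) := by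
  rw [add_pow, Finset.sum_div]
  refine Finset.sum_congr rfl fun j hj => ?_
  rw [Nat.cast_choose ℝ (Finset.mem_range_succ_iff.mp hj)]
  field_simp

theorem tensorExpProd_replicate_zero {n : ℕ} {V : Fin n → Fin (d + 1) → ℝ} (hV : ∀ t, V t 0 = 1)
    (k : ℕ) : tensorExpProd V (List.replicate k 0) = (n : ℝ) ^ k / (k ! : ℝ) := by
  induction n generalizing k with
  | zero => cases k <;> simp [tensorOne, List.replicate_succ]
  | succ n ih =>
    rw [tensorExpProd_succ, tensorMul, List.length_replicate, Nat.cast_succ, add_comm (n : ℝ),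
      add_pow_div_factorial]
    refine Finset.sum_congr rfl fun j hj => ?_
    rw [List.take_replicate, List.drop_replicate, ih fun t => hV t.succ,
      min_eq_left (Finset.mem_range_succ_iff.mp hj)]
    simp [tensorExp, hV]

/-- On the interval of the `t`-th increment, the time left runs from `t.rev + 1` down to `t.rev`. -/
theorem tensorExpProd_cons_replicate_zero {n : ℕ} {V : Fin n → Fin (d + 1) → ℝ}
    (hV : ∀ t, V t 0 = 1) (c : Fin (d + 1)) (k : ℕ) :
    tensorExpProd V (c :: List.replicate k 0) =
      (∑ t, V t c * (((t.rev : ℝ) + 1) ^ (k + 1) - (t.rev : ℝ) ^ (k + 1))) / ((k + 1)! : ℝ) := by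
  induction n with
  | zero => simp [tensorOne]
  | succ n ih =>
    have hfirst : tensorMul (fun z => tensorExp (V 0) (c :: z)) (tensorExpProd fun t => V t.succ)
        (List.replicate k 0) =
          V 0 c * ((((n : ℝ) + 1) ^ (k + 1) - (n : ℝ) ^ (k + 1)) / ((k + 1)! : ℝ)) := by
      rw [sub_div, add_comm (n : ℝ), add_pow_div_factorial, Finset.sum_range_succ', tensorMul,
        List.length_replicate]
      simp only [pow_zero, Nat.factorial_zero, Nat.cast_one, div_one, one_mul, Nat.sub_zero,
        add_sub_cancel_right, Finset.mul_sum]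
      refine Finset.sum_congr rfl fun j hj => ?_
      rw [List.take_replicate, List.drop_replicate, min_eq_left (Finset.mem_range_succ_iff.mp hj),
        tensorExpProd_replicate_zero fun t => hV t.succ, Nat.add_sub_add_right]
      simp [tensorExp, hV, div_eq_mul_inv, mul_assoc]
    rw [tensorExpProd_succ, tensorMul_cons, hfirst, ih fun t => hV t.succ, Fin.sum_univ_succ]
    simp [tensorExp, Fin.rev_succ, add_div, mul_div_assoc]

end TensorAlgebra

section Injectivity

variable {T d : ℕ}

open Polynomial in
theorem sum_mul_eval_add_one_sub_eval_eq_zero {R : Type*} [CommRing R] {ι : Type*} [Fintype ι]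
    {f a : ι → R} (h : ∀ k : ℕ, ∑ i, f i * ((a i + 1) ^ (k + 1) - a i ^ (k + 1)) = 0) (P : R[X]) :
    ∑ i, f i * (P.eval (a i + 1) - P.eval (a i)) = 0 := by
  induction P using Polynomial.induction_on' with
  | add P Q hP hQ =>
    simp only [eval_add, add_sub_add_comm, mul_add, Finset.sum_add_distrib, hP, hQ, add_zero]
  | monomial k c =>
    cases k with
    | zero => simp
    | succ k =>
      rw [← mul_zero c, ← h k, Finset.mul_sum]
      refine Finset.sum_congr rfl fun i _ => ?_
      simp only [eval_monomial]
      ring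

theorem eq_zero_of_sum_mul_pow_sub_pow {R : Type*} [CommRing R] [IsDomain R] [CharZero R] {n : ℕ}
    {f : Fin n → R}
    (h : ∀ k : ℕ, ∑ t, f t * (((t.rev : R) + 1) ^ (k + 1) - (t.rev : R) ^ (k + 1)) = 0) :
    f = 0 := by
  induction n with
  | zero => exact Subsingleton.elim _ _
  | succ n ih =>
    -- This polynomial vanishes at `0, …, n` but not at `n + 1`, so that it isolates `f 0`.
    have hP := sum_mul_eval_add_one_sub_eval_eq_zero h (descPochhammer R (n + 1))
    have heval_zero {k : ℕ} (hk : k < n + 1) : (descPochhammer R (n + 1)).eval (k : R) = 0 :=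
      descPochhammer_eval_coe_nat_of_lt hk
    have heval_last : (descPochhammer R (n + 1)).eval ((n : R) + 1) ≠ 0 := by
      rw [← Nat.cast_succ, descPochhammer_eval_eq_descFactorial, Nat.descFactorial_self]
      exact Nat.cast_ne_zero.mpr (Nat.factorial_ne_zero _)
    have hzero : f 0 = 0 := by
      have htail (t : Fin n) : f t.succ * ((descPochhammer R (n + 1)).eval ((t.succ.rev : R) + 1) -
          (descPochhammer R (n + 1)).eval (t.succ.rev : R)) = 0 := by
        rw [Fin.rev_succ, Fin.val_castSucc, ← Nat.cast_succ,
          heval_zero (Nat.succ_lt_succ t.rev.isLt), heval_zero (Nat.lt_succ_of_lt t.rev.isLt),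
          sub_zero, mul_zero]
      rw [Fin.sum_univ_succ, Finset.sum_eq_zero fun t _ => htail t, add_zero,
        heval_zero (Fin.isLt _), sub_zero] at hP
      simpa [heval_last] using hP
    have hsucc : (fun t : Fin n => f t.succ) = 0 :=
      ih fun k => by simpa [Fin.sum_univ_succ, hzero, Fin.rev_succ] using h k
    funext t
    cases t using Fin.cases with
    | zero => exact hzero
    | succ t => exact congrFun hsucc t

theorem tensorExpProd_injOn (n : ℕ) :
    Set.InjOn (tensorExpProd : (Fin n → Fin (d + 1) → ℝ) → TensorSeries d)
      {V | ∀ t, V t 0 = 1} := by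
  intro V hV W hW hVW
  suffices h : ∀ c, (fun t => V t c - W t c) = 0 from
    funext fun t => funext fun c => sub_eq_zero.mp (congrFun (h c) t)
  refine fun c => eq_zero_of_sum_mul_pow_sub_pow fun k => ?_
  have hcoord := congrFun hVW (c :: List.replicate k 0)
  rw [tensorExpProd_cons_replicate_zero hV, tensorExpProd_cons_replicate_zero hW,
    div_left_inj' (Nat.cast_ne_zero.mpr (Nat.factorial_ne_zero _)), ← sub_eq_zero,
    ← Finset.sum_sub_distrib] at hcoord
  simpa only [sub_mul] using hcoord

theorem sigCoeff_eq_tensorExpProd (x : PathSpace T d) : sigCoeff x = tensorExpProd (increment x) :=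
  rfl

theorem increment_time (x : PathSpace T d) (t : Fin (T + 1)) : increment x t 0 = 1 :=
  rfl

theorem increment_injective :
    Function.Injective (increment : PathSpace T d → Fin (T + 1) → Fin (d + 1) → ℝ) := by
  intro x y hxy
  have hspace (t : Fin (T + 1)) (i : Fin d) := congrFun (congrFun hxy t) i.succ
  funext t
  ext i
  induction t using Fin.induction with
  | zero => simpa [increment] using hspace 0 i
  | succ t ih => simpa [increment, ih] using hspace t.succ i

theorem sigCoeff_injective : Function.Injective (sigCoeff : PathSpace T d → TensorSeries d) :=
  fun x y hxy =>
    increment_injective (tensorExpProd_injOn (T + 1) (increment_time x) (increment_time y) hxy)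

theorem isShuffleCharacter_sigCoeff (x : PathSpace T d) : IsShuffleCharacter (sigCoeff x) :=
  isShuffleCharacter_tensorExpProd (increment x)

theorem sigCoeff_time (x : PathSpace T d) : sigCoeff x [0] = T + 1 := by
  simpa [sigCoeff_eq_tensorExpProd] using tensorExpProd_replicate_zero (increment_time x) 1

end Injectivity

section SequenceSpace

variable {E : ℕ → Type*} [∀ m, NormedAddCommGroup (E m)] {q : ℝ≥0∞} [Fact (1 ≤ q)]

theorem norm_lpSingle (m : ℕ) (a : E m) : ‖lp.single q m a‖ = ‖a‖ :=
  lp.norm_single (zero_lt_one.trans_le Fact.out) m a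

variable [∀ m, NormedSpace ℝ (E m)] [∀ m, CompleteSpace (E m)]

theorem hasSum_lpSingle_of_summable_norm {f : lp E q} (hf : Summable fun m => ‖f m‖) :
    HasSum (fun m => lp.single q m (f m)) f := by
  have hsummable : Summable fun m => lp.single q m (f m) :=
    Summable.of_norm (by simpa only [norm_lpSingle] using hf)
  convert hsummable.hasSum
  ext m : 2
  have hcoord := (hsummable.hasSum.mapL (lp.evalCLM ℝ E q m)).unique
    (hasSum_single m fun k hk => lp.single_apply_ne q k (f k) hk.symm)
  exact ((lp.single_apply_self q m (f m)).symm.trans hcoord.symm)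

theorem lp_norm_le_tsum {f : lp E q} {b : ℕ → ℝ} (hb : Summable b) (hf : ∀ m, ‖f m‖ ≤ b m) :
    ‖f‖ ≤ ∑' m, b m := by
  have hsum := hasSum_lpSingle_of_summable_norm (hb.of_nonneg_of_le (fun _ => norm_nonneg _) hf)
  rw [← hsum.tsum_eq]
  exact tsum_of_norm_bounded hb.hasSum fun m => (norm_lpSingle m _).trans_le (hf m)

theorem lp_tendsto_of_dominated {X : Type*} {l : Filter X} {F : X → lp E q} {f : lp E q}
    {b : ℕ → ℝ} (hb : Summable b) (hF : ∀ᶠ x in l, ∀ m, ‖F x m‖ ≤ b m)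
    (hlim : ∀ m, Tendsto (fun x => F x m) l (𝓝 (f m))) : Tendsto F l (𝓝 f) := by
  obtain rfl | hl := l.eq_or_neBot
  · exact tendsto_bot
  have hsum {g : lp E q} (hg : ∀ m, ‖g m‖ ≤ b m) : ∑' m, lp.single q m (g m) = g :=
    (hasSum_lpSingle_of_summable_norm (hb.of_nonneg_of_le (fun _ => norm_nonneg _) hg)).tsum_eq
  have hf (m : ℕ) : ‖f m‖ ≤ b m := le_of_tendsto (hlim m).norm (hF.mono fun x hx => hx m)
  have hconv : Tendsto (fun x => ∑' m, lp.single q m (F x m)) l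
      (𝓝 (∑' m, lp.single q m (f m))) := by
    refine tendsto_tsum_of_dominated_convergence hb (fun m => ?_)
      (hF.mono fun x hx m => (norm_lpSingle m _).trans_le (hx m))
    rw [tendsto_iff_norm_sub_tendsto_zero]
    simpa only [← lp.single_sub, norm_lpSingle] using
      tendsto_iff_norm_sub_tendsto_zero.mp (hlim m)
  rw [hsum hf] at hconv
  exact hconv.congr' (hF.mono fun x hx => hsum hx)

end SequenceSpace

section Decay

variable {T d : ℕ} {s t : TensorSeries d}

theorem abs_tensorExp_le {v : Fin (d + 1) → ℝ} {C : ℝ} (hv : ‖v‖ ≤ C) (w : List (Fin (d + 1))) :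
    |tensorExp v w| ≤ C ^ w.length / (w.length ! : ℝ) := by
  have hprod : |(w.map v).prod| ≤ C ^ w.length := by
    induction w with
    | nil => simp
    | cons a w ih =>
      rw [List.map_cons, List.prod_cons, abs_mul, List.length_cons, pow_succ']
      exact mul_le_mul ((norm_le_pi_norm v a).trans hv) ih (abs_nonneg _) ((norm_nonneg v).trans hv)
  rw [tensorExp, abs_div, Nat.abs_cast]
  gcongr

theorem abs_tensorMul_le {A B : ℝ} (hs : ∀ w, |s w| ≤ A ^ w.length / (w.length ! : ℝ))
    (ht : ∀ w, |t w| ≤ B ^ w.length / (w.length ! : ℝ)) (w : List (Fin (d + 1))) :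
    |tensorMul s t w| ≤ (A + B) ^ w.length / (w.length ! : ℝ) := by
  rw [add_pow_div_factorial]
  refine (Finset.abs_sum_le_sum_abs _ _).trans (Finset.sum_le_sum fun i hi => ?_)
  have htake := hs (w.take i)
  have hdrop := ht (w.drop i)
  rw [List.length_take, min_eq_left (Finset.mem_range_succ_iff.mp hi)] at htake
  rw [List.length_drop] at hdrop
  exact (abs_mul _ _).trans_le
    (mul_le_mul htake hdrop (abs_nonneg _) ((abs_nonneg _).trans htake))

theorem abs_tensorExpProd_le {n : ℕ} {V : Fin n → Fin (d + 1) → ℝ} {C : ℝ} (hV : ∀ t, ‖V t‖ ≤ C)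
    (w : List (Fin (d + 1))) : |tensorExpProd V w| ≤ (n * C) ^ w.length / (w.length ! : ℝ) := by
  induction n generalizing w with
  | zero => cases w <;> simp [tensorOne]
  | succ n ih =>
    rw [tensorExpProd_succ, Nat.cast_succ, add_comm (n : ℝ), one_add_mul]
    exact abs_tensorMul_le (abs_tensorExp_le (hV 0)) (ih fun t => hV t.succ) w

theorem norm_increment_le (x : PathSpace T d) (t : Fin (T + 1)) :
    ‖increment x t‖ ≤ 1 + 2 * ‖x‖ := by
  have hstep : ‖x t - Fin.cases 0 (fun s : Fin T => x s.castSucc) t‖ ≤ 2 * ‖x‖ := by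
    rw [two_mul]
    refine norm_sub_le_of_le (norm_le_pi_norm x t) ?_
    cases t using Fin.cases with
    | zero => simp
    | succ t => exact norm_le_pi_norm x t.castSucc
  refine (pi_norm_le_iff_of_nonneg (by positivity)).mpr fun c => ?_
  cases c using Fin.cases with
  | zero => simp [increment_time]
  | succ i => exact (PiLp.norm_apply_le _ i).trans (hstep.trans (by simp))

theorem abs_sigCoeff_le {x : PathSpace T d} {r : ℝ} (hx : ‖x‖ ≤ r) (w : List (Fin (d + 1))) :
    |sigCoeff x w| ≤ tensorExp (fun _ => (T + 1 : ℕ) * (1 + 2 * r)) w := by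
  have h := abs_tensorExpProd_le (C := 1 + 2 * r)
    (fun t => (norm_increment_le x t).trans (by gcongr)) w
  simpa [tensorExp, sigCoeff_eq_tensorExpProd] using h

theorem norm_level_le_norm_level (h : ∀ w, |s w| ≤ t w) (m : ℕ) : ‖level s m‖ ≤ ‖level t m‖ := by
  simp only [EuclideanSpace.norm_eq]
  gcongr with w
  exact (h _).trans (le_abs_self _)

theorem abs_le_norm_level (s : TensorSeries d) (w : List (Fin (d + 1))) :
    |s w| ≤ ‖level s w.length‖ := by
  simpa [level] using PiLp.norm_apply_le (level s w.length) w.get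

theorem norm_level_zero (s : TensorSeries d) : ‖level s 0‖ = |s []| := by
  simp [EuclideanSpace.norm_eq, level, Real.sqrt_sq_eq_abs]

theorem level_dilate (a : ℝ) (s : TensorSeries d) (m : ℕ) :
    level (dilate a s) m = a ^ m • level s m := by
  ext w
  simp [level, dilate]

theorem FactorialDecay.summable_norm_level (hs : FactorialDecay s) :
    Summable fun m => ‖level s m‖ := by
  simpa using (hs.memℓp 1).summable (by simp)

end Decay

section Continuity

variable {T d : ℕ} {X : Type*} [TopologicalSpace X]

theorem continuous_tensorMul {s t : X → TensorSeries d} (hs : Continuous s) (ht : Continuous t) :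
    Continuous fun x => tensorMul (s x) (t x) :=
  continuous_pi fun _ => continuous_finsetSum _ fun _ _ =>
    ((continuous_apply _).comp hs).mul ((continuous_apply _).comp ht)

theorem continuous_tensorExp : Continuous (tensorExp : (Fin (d + 1) → ℝ) → TensorSeries d) :=
  continuous_pi fun w =>
    (continuous_list_prod w fun c _ => continuous_apply c).div_const _

theorem continuous_tensorExpProd (n : ℕ) :
    Continuous (tensorExpProd : (Fin n → Fin (d + 1) → ℝ) → TensorSeries d) := by
  induction n with
  | zero => exact continuous_of_const fun V W => by simp only [tensorExpProd_zero]
  | succ n ih =>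
    simp only [funext tensorExpProd_succ]
    exact continuous_tensorMul (continuous_tensorExp.comp (continuous_apply 0))
      (ih.comp (by fun_prop))

theorem continuous_increment :
    Continuous (increment : PathSpace T d → Fin (T + 1) → Fin (d + 1) → ℝ) := by
  refine continuous_pi fun t => continuous_pi fun c => ?_
  cases c using Fin.cases with
  | zero => exact continuous_const
  | succ i => cases t using Fin.cases <;> simp only [increment, Fin.cons_succ, Fin.cases_zero,
      Fin.cases_succ, PiLp.sub_apply] <;> fun_prop

theorem continuous_sigCoeff : Continuous (sigCoeff : PathSpace T d → TensorSeries d) :=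
  (continuous_tensorExpProd (T + 1)).comp continuous_increment

theorem continuous_level (m : ℕ) : Continuous fun s : TensorSeries d => level s m :=
  (PiLp.continuous_toLp 2 _).comp (by fun_prop)

variable {p : ℝ≥0∞} [Fact (1 ≤ p)]

theorem continuous_sig : Continuous (sig p : PathSpace T d → TensorSpace d p) := by
  refine continuous_iff_continuousAt.mpr fun x₀ => ?_
  have hball : ∀ᶠ x in 𝓝 x₀, ‖x‖ ≤ ‖x₀‖ + 1 :=
    continuous_norm.continuousAt.eventually_le_const (lt_add_one _)
  exact lp_tendsto_of_dominated (factorialDecay_exp _).summable_norm_level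
    (hball.mono fun x hx => norm_level_le_norm_level (abs_sigCoeff_le hx))
    fun m => ((continuous_level m).comp continuous_sigCoeff).continuousAt

theorem continuous_scaling : Continuous (scaling p : PathSpace T d → ℝ) :=
  Real.continuous_exp.comp (continuous_sig.norm.neg.sub continuous_norm)

end Continuity

section RobustCoefficients

variable {T d : ℕ} {p q : ℝ≥0∞} [Fact (1 ≤ p)] [Fact (1 ≤ q)]

/-- The coordinates of the robust signature, as those of the signature are given by `sigCoeff`. -/
def robustCoeff (p : ℝ≥0∞) [Fact (1 ≤ p)] (x : PathSpace T d) : TensorSeries d :=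
  dilate (scaling p x) (sigCoeff x)

theorem scaling_pos (x : PathSpace T d) : 0 < scaling p x :=
  Real.exp_pos _

theorem robustCoeff_time (x : PathSpace T d) : robustCoeff p x [0] = scaling p x * (T + 1) := by
  simp [robustCoeff, dilate, sigCoeff_time]

theorem robustCoeff_injective : Function.Injective (robustCoeff p : PathSpace T d → _) := by
  intro x y hxy
  have hscaling : scaling p x = scaling p y := by
    have htime := congrFun hxy [0]
    rw [robustCoeff_time, robustCoeff_time] at htime
    exact mul_right_cancel₀ (by positivity) htime
  refine sigCoeff_injective (funext fun w => ?_)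
  have hw := congrFun hxy w
  rw [robustCoeff, robustCoeff, hscaling] at hw
  exact mul_left_cancel₀ (pow_ne_zero _ (scaling_pos y).ne') hw

theorem isShuffleCharacter_robustCoeff (x : PathSpace T d) :
    IsShuffleCharacter (robustCoeff p x) :=
  (isShuffleCharacter_sigCoeff x).dilate _

theorem continuous_robustCoeff : Continuous (robustCoeff p : PathSpace T d → TensorSeries d) :=
  continuous_pi fun w =>
    (continuous_scaling.pow _).mul ((continuous_apply w).comp continuous_sigCoeff)

theorem norm_level_sigCoeff_le_norm_sig (p : ℝ≥0∞) [Fact (1 ≤ p)] (x : PathSpace T d) (m : ℕ) :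
    ‖level (sigCoeff x) m‖ ≤ ‖sig p x‖ :=
  lp.norm_apply_le_norm (zero_lt_one.trans_le Fact.out).ne' (sig p x) m

theorem norm_level_sigCoeff_le_pow (p : ℝ≥0∞) [Fact (1 ≤ p)] (x : PathSpace T d) (m : ℕ) :
    ‖level (sigCoeff x) m‖ ≤ ‖sig p x‖ ^ m := by
  have hzero : ‖level (sigCoeff x) 0‖ = 1 := by
    rw [norm_level_zero, (isShuffleCharacter_sigCoeff x).map_nil, abs_one]
  obtain rfl | hm := eq_or_ne m 0
  · rw [hzero, pow_zero]
  · have hone : 1 ≤ ‖sig p x‖ := hzero.symm.trans_le (norm_level_sigCoeff_le_norm_sig p x 0)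
    exact (norm_level_sigCoeff_le_norm_sig p x m).trans (le_self_pow₀ hone hm)

theorem scaling_mul_norm_sig_le (x : PathSpace T d) :
    scaling p x * ‖sig p x‖ ≤ Real.exp (-1 - ‖x‖) := by
  calc scaling p x * ‖sig p x‖
      ≤ scaling p x * Real.exp (‖sig p x‖ - 1) := by
        gcongr
        · exact (scaling_pos x).le
        · linarith [Real.add_one_le_exp (‖sig p x‖ - 1)]
    _ = Real.exp (-1 - ‖x‖) := by
        rw [scaling, ← Real.exp_add]
        ring_nf

theorem norm_level_robustCoeff_le (x : PathSpace T d) (m : ℕ) :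
    ‖level (robustCoeff p x) m‖ ≤ Real.exp (-1 - ‖x‖) ^ m := by
  have hpos := (scaling_pos (p := p) x).le
  rw [robustCoeff, level_dilate, norm_smul, norm_pow, Real.norm_of_nonneg hpos]
  calc scaling p x ^ m * ‖level (sigCoeff x) m‖
      ≤ scaling p x ^ m * ‖sig p x‖ ^ m := by
        gcongr
        exact norm_level_sigCoeff_le_pow p x m
    _ = (scaling p x * ‖sig p x‖) ^ m := (mul_pow _ _ _).symm
    _ ≤ Real.exp (-1 - ‖x‖) ^ m := by
        gcongr
        exact scaling_mul_norm_sig_le x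

theorem abs_robustCoeff_le (x : PathSpace T d) (w : List (Fin (d + 1))) :
    |robustCoeff p x w| ≤ Real.exp (-1 - ‖x‖) ^ w.length :=
  (abs_le_norm_level _ w).trans (norm_level_robustCoeff_le x _)

theorem summable_exp_neg_one_pow : Summable fun m : ℕ => Real.exp (-1) ^ m :=
  summable_geometric_of_lt_one (Real.exp_pos _).le (Real.exp_lt_one_iff.mpr (by norm_num))

theorem norm_robustSig_apply_le (x : PathSpace T d) (m : ℕ) :
    ‖robustSig p q x m‖ ≤ Real.exp (-1) ^ m := by
  refine (norm_level_robustCoeff_le x m).trans ?_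
  gcongr
  linarith [norm_nonneg x]

theorem continuous_robustSig : Continuous (robustSig p q : PathSpace T d → TensorSpace d q) :=
  continuous_iff_continuousAt.mpr fun _ =>
    lp_tendsto_of_dominated summable_exp_neg_one_pow
      (Eventually.of_forall norm_robustSig_apply_le)
      fun m => ((continuous_level m).comp continuous_robustCoeff).continuousAt

theorem tendsto_robustCoeff_cocompact :
    Tendsto (robustCoeff p) (cocompact (PathSpace T d)) (𝓝 tensorOne) := by
  have hexp : Tendsto (fun x : PathSpace T d => Real.exp (-1 - ‖x‖)) (cocompact _) (𝓝 0) :=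
    Real.tendsto_exp_atBot.comp (tendsto_atBot_add_const_left _ (-1)
      (tendsto_neg_atTop_atBot.comp tendsto_norm_cocompact_atTop))
  refine tendsto_pi_nhds.mpr fun w => ?_
  obtain rfl | hw := eq_or_ne w []
  · simpa [(isShuffleCharacter_robustCoeff _).map_nil, tensorOne] using tendsto_const_nhds
  · have hpow := hexp.pow w.length
    rw [zero_pow (List.length_eq_zero_iff.not.mpr hw)] at hpow
    simpa [tensorOne, hw] using squeeze_zero_norm (fun x => abs_robustCoeff_le x w) hpow

end RobustCoefficients

section Expectation

variable {T d : ℕ} {p q : ℝ≥0∞} [Fact (1 ≤ p)] [Fact (1 ≤ q)]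

theorem integrable_robustSig (ν : Measure (PathSpace T d)) [IsFiniteMeasure ν] :
    Integrable (robustSig p q) ν :=
  Integrable.of_bound continuous_robustSig.aestronglyMeasurable _
    (Eventually.of_forall fun x =>
      lp_norm_le_tsum summable_exp_neg_one_pow (norm_robustSig_apply_le x))

theorem expectedRobustSig_apply (ν : ProbabilityMeasure (PathSpace T d)) (m : ℕ) :
    expectedRobustSig p q ν m = ∫ x, robustSig p q x m ∂(ν : Measure (PathSpace T d)) :=
  ((lp.evalCLM ℝ (Level d) q m).integral_comp_comm (integrable_robustSig _)).symm

theorem norm_expectedRobustSig_apply_le (ν : ProbabilityMeasure (PathSpace T d)) (m : ℕ) :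
    ‖expectedRobustSig p q ν m‖ ≤ Real.exp (-1) ^ m := by
  rw [expectedRobustSig_apply]
  simpa using norm_integral_le_of_norm_le_const (μ := (ν : Measure (PathSpace T d)))
    (Eventually.of_forall fun x => norm_robustSig_apply_le (p := p) (q := q) x m)

/-- The coordinate of a tensor series at a word of length `m`, as a continuous functional. -/
def coordCLM (q : ℝ≥0∞) [Fact (1 ≤ q)] (m : ℕ) (w : Fin m → Fin (d + 1)) :
    TensorSpace d q →L[ℝ] ℝ :=
  (EuclideanSpace.proj w).comp (lp.evalCLM ℝ (Level d) q m)

theorem coordCLM_expectedRobustSig (ν : ProbabilityMeasure (PathSpace T d)) (m : ℕ)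
    (w : Fin m → Fin (d + 1)) :
    coordCLM q m w (expectedRobustSig p q ν) =
      ∫ x, robustCoeff p x (List.ofFn w) ∂(ν : Measure (PathSpace T d)) :=
  ((coordCLM q m w).integral_comp_comm (integrable_robustSig _)).symm

theorem tendsto_expectedRobustSig_iff {ι : Type*} {l : Filter ι}
    {μs : ι → ProbabilityMeasure (PathSpace T d)} {μ : ProbabilityMeasure (PathSpace T d)} :
    Tendsto (fun i => expectedRobustSig p q (μs i)) l (𝓝 (expectedRobustSig p q μ)) ↔
      ∀ w, Tendsto (fun i => ∫ x, robustCoeff p x w ∂(μs i : Measure (PathSpace T d))) l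
        (𝓝 (∫ x, robustCoeff p x w ∂(μ : Measure (PathSpace T d)))) := by
  refine ⟨fun h w => ?_, fun h => ?_⟩
  · have hw := ((coordCLM q w.length w.get).continuous.tendsto _).comp h
    simpa only [Function.comp_def, coordCLM_expectedRobustSig, List.ofFn_get] using hw
  · refine lp_tendsto_of_dominated summable_exp_neg_one_pow
      (Eventually.of_forall fun i => norm_expectedRobustSig_apply_le (μs i)) fun m => ?_
    rw [(PiLp.homeomorph 2 _).isInducing.tendsto_nhds_iff, tendsto_pi_nhds]
    intro w
    have hw := h (List.ofFn w)
    simp only [← coordCLM_expectedRobustSig (q := q)] at hw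
    exact hw

end Expectation

section WeakConvergence

variable {ι : Type*} {l : Filter ι}

theorem tendsto_of_subalgebra_separatesPoints {K : Type*} [TopologicalSpace K] [CompactSpace K]
    [MeasurableSpace K] [OpensMeasurableSpace K] {A : Subalgebra ℝ C(K, ℝ)}
    (hA : A.SeparatesPoints) {νs : ι → ProbabilityMeasure K} {ν : ProbabilityMeasure K}
    (h : ∀ F ∈ A, Tendsto (fun i => ∫ x, F x ∂(νs i : Measure K)) l
      (𝓝 (∫ x, F x ∂(ν : Measure K)))) :
    Tendsto νs l (𝓝 ν) := by
  have hlipschitz (μ : ProbabilityMeasure K) :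
      LipschitzWith 1 fun F : C(K, ℝ) => ∫ x, F x ∂(μ : Measure K) := by
    refine LipschitzWith.of_dist_le_mul fun F G => ?_
    have hint (H : C(K, ℝ)) : Integrable H (μ : Measure K) :=
      (BoundedContinuousFunction.mkOfCompact H).integrable _
    rw [dist_eq_norm, ← integral_sub (hint F) (hint G), NNReal.coe_one, one_mul]
    simpa using norm_integral_le_of_norm_le_const (μ := (μ : Measure K))
      (Eventually.of_forall fun x =>
        (dist_eq_norm (F x) (G x)).symm.trans_le (ContinuousMap.dist_apply_le_dist x))
  have hequi : Equicontinuous fun i (F : C(K, ℝ)) => ∫ x, F x ∂(νs i : Measure K) :=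
    (LipschitzWith.uniformEquicontinuous _ 1 fun i => hlipschitz (νs i)).equicontinuous
  have hclosed := hequi.isClosed_setOfPred_tendsto (l := l) (hlipschitz ν).continuous
  refine ProbabilityMeasure.tendsto_iff_forall_integral_tendsto.mpr fun F => ?_
  exact closure_minimal h hclosed
    (ContinuousMap.continuousMap_mem_subalgebra_closure_of_separatesPoints A hA F.toContinuousMap)

theorem tendsto_of_tendsto_map_isInducing {X Y : Type*} [TopologicalSpace X] [MeasurableSpace X]
    [OpensMeasurableSpace X] [TopologicalSpace Y] [MeasurableSpace Y] [BorelSpace Y]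
    [HasOuterApproxClosed Y] {f : X → Y} (hf : IsInducing f) [l.IsCountablyGenerated]
    {μs : ι → ProbabilityMeasure X} {μ : ProbabilityMeasure X}
    (h : Tendsto (fun i => (μs i).map hf.continuous.aemeasurable) l
      (𝓝 (μ.map hf.continuous.aemeasurable))) :
    Tendsto μs l (𝓝 μ) := by
  refine tendsto_of_forall_isOpen_le_liminf' fun G hG => ?_
  obtain ⟨V, hV, rfl⟩ := hf.isOpen_iff.mp hG
  have hle := ProbabilityMeasure.le_liminf_measure_open_of_tendsto h hV
  simpa only [ProbabilityMeasure.toMeasure_map,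
    Measure.map_apply hf.continuous.measurable hV.measurableSet] using hle

theorem isEmbedding_of_tendsto_cocompact {X Y : Type*} [TopologicalSpace X] [R1Space X]
    [TopologicalSpace Y] [T2Space Y] {f : X → Y} {y : Y} (hf : Continuous f)
    (hinj : Function.Injective f) (hlim : Tendsto f (cocompact X) (𝓝 y)) (hy : ∀ x, f x ≠ y) :
    IsEmbedding f := by
  let g : C(OnePoint X, Y) :=
    OnePoint.continuousMapMk ⟨f, hf⟩ y (by rwa [coclosedCompact_eq_cocompact])
  have hg : Function.Injective g := by
    intro a b hab
    induction a using OnePoint.rec <;> induction b using OnePoint.rec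
    · rfl
    · exact absurd hab.symm (hy _)
    · exact absurd hab (hy _)
    · exact congrArg _ (hinj hab)
  exact (g.continuous.isClosedEmbedding hg).isEmbedding.comp
    OnePoint.isOpenEmbedding_coe.isEmbedding

end WeakConvergence

section ShuffleCharacters

variable {α : Type*}

/-- The shuffle characters with coordinates in `[-1, 1]`, a compact set on which the coordinate
functions span an algebra. -/
def unitShuffleCharacters (α : Type*) : Set (List α → ℝ) :=
  {s | IsShuffleCharacter s ∧ ∀ w, s w ∈ Set.Icc (-1) 1}

theorem isClosed_setOf_isShuffleCharacter : IsClosed {s : List α → ℝ | IsShuffleCharacter s} := by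
  have hinter : {s : List α → ℝ | IsShuffleCharacter s} =
      {s | s [] = 1} ∩ ⋂ w, ⋂ u, {s | ((shuffles w u).map s).sum = s w * s u} := by
    ext s
    simp only [Set.mem_inter_iff, Set.mem_iInter]
    exact ⟨fun hs => ⟨hs.map_nil, hs.sum_map_shuffles⟩, fun hs => ⟨hs.1, hs.2⟩⟩
  rw [hinter]
  refine (isClosed_eq (continuous_apply _) continuous_const).inter
    (isClosed_iInter fun w => isClosed_iInter fun u => isClosed_eq ?_ (by fun_prop))
  exact continuous_list_sum _ fun z _ => continuous_apply z

instance compactSpace_unitShuffleCharacters : CompactSpace (unitShuffleCharacters α) := by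
  refine isCompact_iff_compactSpace.mp ?_
  have hcube : IsCompact (Set.univ.pi fun _ : List α => Set.Icc (-1 : ℝ) 1) :=
    isCompact_univ_pi fun _ => isCompact_Icc
  convert hcube.inter_left isClosed_setOf_isShuffleCharacter using 1
  ext s
  exact and_congr_right fun _ => Set.mem_univ_pi.symm

/-- The coordinate at a word, as a function on `unitShuffleCharacters`. -/
def shuffleCoord (w : List α) : C(unitShuffleCharacters α, ℝ) :=
  ⟨fun s => s.1 w, (continuous_apply w).comp continuous_subtype_val⟩

theorem isShuffleCharacter_shuffleCoord :
    IsShuffleCharacter (shuffleCoord : List α → C(unitShuffleCharacters α, ℝ)) := by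
  refine ⟨ContinuousMap.ext fun s => s.2.1.map_nil, fun w u => ContinuousMap.ext fun s => ?_⟩
  have heval := map_list_sum (ContinuousMap.evalAlgHom ℝ ℝ s) ((shuffles w u).map shuffleCoord)
  rw [List.map_map] at heval
  exact heval.trans (s.2.1.sum_map_shuffles w u)

theorem separatesPoints_subalgebra_shuffleCoord :
    ((isShuffleCharacter_shuffleCoord (α := α)).subalgebra ℝ).SeparatesPoints := by
  intro s t hst
  obtain ⟨w, hw⟩ := Function.ne_iff.mp (Subtype.coe_ne_coe.mpr hst)
  exact ⟨_, ⟨shuffleCoord w, Submodule.subset_span (Set.mem_range_self w), rfl⟩, hw⟩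

theorem tendsto_of_tendsto_integral_shuffleCoord [Countable α] {ι : Type*} {l : Filter ι}
    {νs : ι → ProbabilityMeasure (unitShuffleCharacters α)}
    {ν : ProbabilityMeasure (unitShuffleCharacters α)}
    (h : ∀ w, Tendsto (fun i => ∫ s, shuffleCoord w s ∂(νs i : Measure (unitShuffleCharacters α))) l
      (𝓝 (∫ s, shuffleCoord w s ∂(ν : Measure (unitShuffleCharacters α))))) :
    Tendsto νs l (𝓝 ν) := by
  refine tendsto_of_subalgebra_separatesPoints separatesPoints_subalgebra_shuffleCoord ?_
  intro F hF
  have hint (G : C(unitShuffleCharacters α, ℝ))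
      (μ : ProbabilityMeasure (unitShuffleCharacters α)) : Integrable G (μ : Measure _) :=
    (BoundedContinuousFunction.mkOfCompact G).integrable _
  induction hF using Submodule.span_induction with
  | mem F hF =>
    obtain ⟨w, rfl⟩ := hF
    exact h w
  | zero => simp [tendsto_const_nhds]
  | add F G _ _ hF hG =>
    simpa only [ContinuousMap.add_apply, integral_add (hint F _) (hint G _)] using hF.add hG
  | smul c F _ hF =>
    simpa only [ContinuousMap.smul_apply, smul_eq_mul, integral_const_mul] using hF.const_mul c

end ShuffleCharacters

section RobustEmbedding

variable {T d : ℕ} {p q : ℝ≥0∞} [Fact (1 ≤ p)] [Fact (1 ≤ q)]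

theorem robustCoeff_mem_unitShuffleCharacters (x : PathSpace T d) :
    robustCoeff p x ∈ unitShuffleCharacters (Fin (d + 1)) :=
  ⟨isShuffleCharacter_robustCoeff x, fun w => abs_le.mp <|
    (abs_robustCoeff_le x w).trans <| pow_le_one₀ (Real.exp_pos _).le <|
      Real.exp_le_one_iff.mpr (by linarith [norm_nonneg x])⟩

theorem isEmbedding_robustCoeff :
    IsEmbedding (robustCoeff p : PathSpace T d → TensorSeries d) := by
  refine isEmbedding_of_tendsto_cocompact continuous_robustCoeff robustCoeff_injective
    tendsto_robustCoeff_cocompact fun x hx => ?_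
  have htime := congrFun hx [0]
  rw [robustCoeff_time] at htime
  have hpos := scaling_pos (p := p) x
  exact (by positivity : scaling p x * ((T : ℝ) + 1) ≠ 0) (by simpa [tensorOne] using htime)

theorem tendsto_iff_tendsto_integral_robustCoeff {ι : Type*} {l : Filter ι}
    [l.IsCountablyGenerated] {μs : ι → ProbabilityMeasure (PathSpace T d)}
    {μ : ProbabilityMeasure (PathSpace T d)} :
    Tendsto μs l (𝓝 μ) ↔
      ∀ w, Tendsto (fun i => ∫ x, robustCoeff p x w ∂(μs i : Measure (PathSpace T d))) l
        (𝓝 (∫ x, robustCoeff p x w ∂(μ : Measure (PathSpace T d)))) := by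
  let f (x : PathSpace T d) : unitShuffleCharacters (Fin (d + 1)) :=
    ⟨robustCoeff p x, robustCoeff_mem_unitShuffleCharacters x⟩
  have hf : IsInducing f := (isEmbedding_robustCoeff.codRestrict _ _).isInducing
  have hfm (ν : ProbabilityMeasure (PathSpace T d)) : AEMeasurable f (ν : Measure _) :=
    hf.continuous.aemeasurable
  refine ⟨fun h w => ?_, fun h => tendsto_of_tendsto_map_isInducing hf ?_⟩
  · exact ProbabilityMeasure.tendsto_iff_forall_integral_tendsto.mp h
      ((BoundedContinuousFunction.mkOfCompact (shuffleCoord w)).compContinuous ⟨f, hf.continuous⟩)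
  · refine tendsto_of_tendsto_integral_shuffleCoord fun w => ?_
    simp only [ProbabilityMeasure.toMeasure_map,
      integral_map (hfm _) (shuffleCoord w).continuous.aestronglyMeasurable]
    exact h w

end RobustEmbedding

end RobustSignature

end

theorem proposition4p9_general (T d : ℕ) (p q : ℝ≥0∞) [Fact (1 ≤ p)] [Fact (1 ≤ q)] :
    (∀ ν : ProbabilityMeasure (RobustSignature.PathSpace T d),
      Integrable (RobustSignature.robustSig p q) (ν : Measure (RobustSignature.PathSpace T d))) ∧
    ∀ (μs : ℕ → ProbabilityMeasure (RobustSignature.PathSpace T d))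
      (μ : ProbabilityMeasure (RobustSignature.PathSpace T d)),
      Tendsto μs atTop (𝓝 μ) ↔
        Tendsto (fun n => RobustSignature.d0 p q (μs n) μ) atTop (𝓝 0) := by
  refine ⟨fun ν => RobustSignature.integrable_robustSig _, fun μs μ => ?_⟩
  rw [RobustSignature.tendsto_iff_tendsto_integral_robustCoeff (p := p),
    ← RobustSignature.tendsto_expectedRobustSig_iff (q := q), tendsto_iff_norm_sub_tendsto_zero]
  rfl

theorem proposition4p9 (T d : ℕ) (p q : ℝ≥0∞) [Fact (1 ≤ p)] [Fact (1 ≤ q)]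
    (hp : p = 1 ∨ p = 2) (hq : q = 1 ∨ q = 2) :
    (∀ ν : ProbabilityMeasure (RobustSignature.PathSpace T d),
      Integrable (RobustSignature.robustSig p q) (ν : Measure (RobustSignature.PathSpace T d))) ∧
    ∀ (μs : ℕ → ProbabilityMeasure (RobustSignature.PathSpace T d))
      (μ : ProbabilityMeasure (RobustSignature.PathSpace T d)),
      Tendsto μs atTop (𝓝 μ) ↔
        Tendsto (fun n => RobustSignature.d0 p q (μs n) μ) atTop (𝓝 0) :=
  proposition4p9_general T d p q
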